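/- Let $\rho>1$ and let $\mathcal E_\rho=\{\tfrac12(w+w^{-1}) : w\in\mathbb C,\ |w|=\rho\}$ be the Bernstein ellipse, i.e. the ellipse with foci $\pm1$ and semi-axes $\tfrac12(\rho+\rho^{-1})$, $\tfrac12(\rho-\rho^{-1})$. Let $u$ be a complex-valued function that is analytic on and within $\mathcal E_\rho$ (that is, at every point of the closed region bounded by $\mathcal E_\rho$), and let $M=\max_{z\in\mathcal E_\rho}|u(z)|$. Let $\alpha,\beta>-1$ be real and let $n\ge 0$ be an integer. Put $\omega^{\alpha,\beta}(x)=(1-x)^\alpha(1+x)^\beta$ and let $J_n^{\alpha,\beta}$ be the Jacobi polynomial of degree $n$ in Szegő's normalization, given by Rodrigues' formula $$\omega^{\alpha,\beta}(x)J_n^{\alpha,\beta}(x)=\frac{(-1)^n}{2^n n!}\frac{d^n}{dx^n}\Big[(1-x)^{\alpha+n}(1+x)^{\beta+n}\Big],\qquad -1<x<1 .$$ Let $$\gamma_n^{\alpha,\beta}=\frac{2^{\alpha+\beta+1}\,\Gamma(n+\alpha+1)\Gamma(n+\beta+1)}{(2n+\alpha+\beta+1)\,n!\,\Gamma(n+\alpha+\beta+1)},$$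 $$\hat u_n^{\alpha,\beta}=\frac1{\gamma_n^{\alpha,\beta}}\int_{-1}^1u(x)J_n^{\alpha,\beta}(x)\,\omega^{\alpha,\beta}(x)\,dx,\qquad \sigma_{n,j}^{\alpha,\beta}=\frac1{\gamma_n^{\alpha,\beta}}\int_{-1}^1U_{n+j}(x)J_n^{\alpha,\beta}(x)\,\omega^{\alpha,\beta}(x)\,dx\quad(j\ge0),$$ where $U_k$ is the Chebyshev polynomial of the second kind of degree $k$. For $n=0$ the product $(\alpha+\beta+1)\Gamma(\alpha+\beta+1)$ in $\gamma_0^{\alpha,\beta}$ is read as $\Gamma(\alpha+\beta+2)$. Then $$\big|\hat u_n^{\alpha,\beta}\big|\le\frac{M}{\rho^n}\bigg[\big|\sigma_{n,0}^{\alpha,\beta}\big|+\frac{|\sigma_{n,1}^{\alpha,\beta}|}{\rho}+\frac{2}{\rho(\rho-1)}\sqrt{\frac{\gamma_0^{\alpha,\beta}}{\gamma_n^{\alpha,\beta}}}\,\bigg],$$ where $$\sigma_{n,0}^{\alpha,\beta}=\frac{\sqrt\pi}{2}\,\frac{(2n+1)!\,\Gamma(n+\alpha+\beta+1)}{\Gamma(n+3/2)\,\Gamma(2n+\alpha+\beta+1)},\qquad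 \sigma_{n,1}^{\alpha,\beta}=\frac{(\beta-\alpha)(2n+2)}{2n+\alpha+\beta+2}\,\sigma_{n,0}^{\alpha,\beta}$$ (for $n=0$ and $\alpha+\beta=-1$ the first formula is read as its limit $\sigma_{0,0}^{\alpha,\beta}=1$). In particular, if $\alpha=\beta$, then $$\big|\hat u_n^{\alpha,\alpha}\big|\le\frac{M}{\rho^n}\bigg[\big|\sigma_{n,0}^{\alpha,\alpha}\big|+\frac{2}{\rho^2-1}\sqrt{\frac{\gamma_0^{\alpha,\alpha}}{\gamma_n^{\alpha,\alpha}}}\,\bigg].$$ -/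

import Mathlib

open scoped Nat

noncomputable section

namespace JacobiExpansion

/-- The Bernstein ellipse `E_ρ`: the image of the circle `|w| = ρ` under `w ↦ (w + w⁻¹) / 2`. -/
def bernsteinEllipse (ρ : ℝ) : Set ℂ :=
  {z | ∃ w : ℂ, ‖w‖ = ρ ∧ z = (w + w⁻¹) / 2}

/-- The closed region bounded by `E_ρ` (the points on and within `E_ρ`), described by the
semi-axes `a = (ρ + ρ⁻¹) / 2` and `b = (ρ - ρ⁻¹) / 2` (for `ρ > 1`). -/
def bernsteinRegion (ρ : ℝ) : Set ℂ :=
  {z | (z.re / ((ρ + ρ⁻¹) / 2)) ^ 2 + (z.im / ((ρ - ρ⁻¹) / 2)) ^ 2 ≤ 1}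

/-- The Jacobi weight `ω(x) = (1 - x)^α (1 + x)^β`, used on `(-1, 1)`. -/
def jacobiWeight (α β x : ℝ) : ℝ := (1 - x) ^ α * (1 + x) ^ β

/-- The Jacobi polynomial of degree `n` in Szegő's normalization,
`∑ i ≤ n, C(n+α, i) C(n+β, n-i) ((x-1)/2)^(n-i) ((x+1)/2)^i`, with generalized binomial
coefficients `C(r, i) = r (r-1) ⋯ (r-i+1) / i!`.
Rodrigues' formula for it is `jacobi_rodrigues` below. -/
def jacobi (n : ℕ) (α β : ℝ) : Polynomial ℝ :=
  ∑ i ∈ Finset.range (n + 1),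
    Polynomial.C (((descPochhammer ℝ i).eval (n + α) / i !) *
        ((descPochhammer ℝ (n - i)).eval (n + β) / (n - i)!)) *
      (Polynomial.C (1 / 2) * (Polynomial.X - 1)) ^ (n - i) *
      (Polynomial.C (1 / 2) * (Polynomial.X + 1)) ^ i

/-- Rodrigues' formula. -/
theorem jacobi_rodrigues (n : ℕ) (α β x : ℝ) (hx : -1 < x) (hx' : x < 1) :
    jacobiWeight α β x * (jacobi n α β).eval x =
      (-1) ^ n / (2 ^ n * n !) *
        iteratedDeriv n (fun t : ℝ => (1 - t) ^ (α + n) * (1 + t) ^ (β + n)) x := by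
  have h1 : (0 : ℝ) < 1 - x := by linarith
  have h2 : (0 : ℝ) < 1 + x := by linarith
  have c1 : ContDiffAt ℝ n (fun t : ℝ => (1 - t) ^ (α + n)) x :=
    ContDiffAt.rpow_const_of_ne (by fun_prop) h1.ne'
  have c2 : ContDiffAt ℝ n (fun t : ℝ => (1 + t) ^ (β + n)) x :=
    ContDiffAt.rpow_const_of_ne (by fun_prop) h2.ne'
  rw [iteratedDeriv_fun_mul c1 c2, jacobiWeight, jacobi, Polynomial.eval_finsetSum,
    Finset.mul_sum, Finset.mul_sum]
  refine Finset.sum_congr rfl fun i hi => ?_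
  have hin : i ≤ n := Nat.lt_succ_iff.mp (Finset.mem_range.mp hi)
  rw [iteratedDeriv_comp_const_sub (f := fun t : ℝ => t ^ (α + n)),
    iteratedDeriv_comp_const_add (f := fun t : ℝ => t ^ (β + n))]
  simp only [iteratedDeriv_eq_iterate, Real.iter_deriv_rpow_const, smul_eq_mul]
  obtain ⟨k, rfl⟩ := Nat.exists_eq_add_of_le hin
  have e1 : (1 - x) ^ (α + ((i + k : ℕ) : ℝ) - i) = (1 - x) ^ α * (1 - x) ^ k := by
    rw [← Real.rpow_natCast, ← Real.rpow_add h1]; push_cast; ring_nf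
  have e2 : (1 + x) ^ (β + ((i + k : ℕ) : ℝ) - ((i + k - i : ℕ) : ℝ))
      = (1 + x) ^ β * (1 + x) ^ i := by
    rw [← Real.rpow_natCast (1 + x), ← Real.rpow_add h2, Nat.add_sub_cancel_left]
    push_cast; ring_nf
  rw [e1, e2, Nat.add_sub_cancel_left, Nat.cast_add_choose]
  simp only [Polynomial.eval_mul, Polynomial.eval_C, Polynomial.eval_pow, Polynomial.eval_sub,
    Polynomial.eval_add, Polynomial.eval_X, Polynomial.eval_one]
  have e3 : (1 / 2 * (x - 1)) ^ k = (-1) ^ k * (1 - x) ^ k / 2 ^ k := by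
    rw [← mul_pow, ← div_pow]; ring_nf
  have e4 : (1 / 2 * (x + 1)) ^ i = (1 + x) ^ i / 2 ^ i := by
    rw [← div_pow]; ring_nf
  have e5 : ((-1 : ℝ) ^ i) * (-1) ^ i = 1 := by rw [← mul_pow]; norm_num
  rw [e3, e4, pow_add, pow_add, add_comm (((i + k : ℕ) : ℝ)) α, add_comm (((i + k : ℕ) : ℝ)) β]
  have f1 : ((i ! : ℕ) : ℝ) ≠ 0 := by positivity
  have f2 : ((k ! : ℕ) : ℝ) ≠ 0 := by positivity
  have f3 : (((i + k)! : ℕ) : ℝ) ≠ 0 := by positivity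
  field_simp
  linear_combination (-((descPochhammer ℝ i).eval (α + ((i + k : ℕ) : ℝ)) *
    (descPochhammer ℝ k).eval (β + ((i + k : ℕ) : ℝ)))) * e5

/-- The normalization factor `γ_n`, that is
`2^(α+β+1) Γ(n+α+1) Γ(n+β+1) / ((2n+α+β+1) n! Γ(n+α+β+1))`. For `n = 0` the product
`(α+β+1) Γ(α+β+1)` is written as `Γ(α+β+2)`, which also covers the removable singularity
`α + β + 1 = 0`; compare `jacobiGamma_eq`. -/
def jacobiGamma (n : ℕ) (α β : ℝ) : ℝ :=
  2 ^ (α + β + 1) * Real.Gamma (n + α + 1) * Real.Gamma (n + β + 1) /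
    (n ! * (if n = 0 then Real.Gamma (α + β + 2)
      else (2 * n + α + β + 1) * Real.Gamma (n + α + β + 1)))

theorem jacobiGamma_eq (n : ℕ) (α β : ℝ) (h : n ≠ 0 ∨ α + β + 1 ≠ 0) :
    jacobiGamma n α β =
      2 ^ (α + β + 1) * Real.Gamma (n + α + 1) * Real.Gamma (n + β + 1) /
        ((2 * n + α + β + 1) * n ! * Real.Gamma (n + α + β + 1)) := by
  unfold jacobiGamma
  split_ifs with hn
  · subst hn
    have h' : α + β + 1 ≠ 0 := by simpa using h
    have e : Real.Gamma (α + β + 2) = (α + β + 1) * Real.Gamma (α + β + 1) := by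
      rw [← Real.Gamma_add_one h']; ring_nf
    rw [e]; simp
  · congr 1; ring

/-- The Jacobi expansion coefficient
`û_n = (1/γ_n) ∫_{-1}^{1} u(x) J_n(x) ω(x) dx` of a complex-valued function `u`. -/
def jacobiCoeff (u : ℂ → ℂ) (n : ℕ) (α β : ℝ) : ℂ :=
  (1 / (jacobiGamma n α β : ℂ)) *
    ∫ x in (-1 : ℝ)..1, u x * (((jacobi n α β).eval x * jacobiWeight α β x : ℝ) : ℂ)

/-- The number `σ_{n,j} = (1/γ_n) ∫_{-1}^{1} U_{n+j}(x) J_n(x) ω(x) dx`, where `U_k` is the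
Chebyshev polynomial of the second kind of degree `k`. -/
def sigma (n j : ℕ) (α β : ℝ) : ℝ :=
  (1 / jacobiGamma n α β) *
    ∫ x in (-1 : ℝ)..1, (Polynomial.Chebyshev.U ℝ (n + j)).eval x *
      (jacobi n α β).eval x * jacobiWeight α β x

end JacobiExpansion

end

noncomputable section

namespace JacobiExpansion

open Polynomial MeasureTheory Set

/-! Under `x = (w + w⁻¹) / 2` the function `u` becomes holomorphic on `1 ≤ |w| ≤ ρ`, and moving the
contour to `|w| = ρ` gives `u = ∑ a_k T_k` on `[-1, 1]` with `|a_k| ≤ 2M / ρ^k` and `|a_0| ≤ M`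
(`exists_chebyshev_expansion`). Integrating termwise against `J_n ω / γ_n` yields `û_n = ∑ a_k τ_k`,
where `τ_k` is `chebyshevJacobi n k`.

Orthogonality kills `τ_k` for `k < n`. Since `2 T_k = U_k - U_{k-2}` and `U_{k-2}` has degree below
`n` for `k = n, n + 1`, the first two surviving terms carry `σ_{n,0}` and `σ_{n,1}`
(`two_mul_chebyshevJacobi_add`). All others obey `|τ_k| ≤ √(γ_0 / γ_n)` by `|T_k| ≤ 1` and
Cauchy–Schwarz, and form a geometric tail. If `α = β`, parity removes every second term.

The closed forms come from Rodrigues' formula: `n` integrations by parts turn `∫ p J_n ω` into a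
multiple of `∫ p^(n)` against the weight with both exponents raised by `n`
(`jacobiIntegral_mul_jacobi`), hence into a beta integral. -/

theorem intervalIntegrable_jacobiWeight {a b : ℝ} (ha : -1 < a) (hb : -1 < b) :
    IntervalIntegrable (jacobiWeight a b) volume (-1) 1 := by
  have h1 : IntervalIntegrable (fun x : ℝ => (1 - x) ^ a) volume 0 1 := by
    simpa using (intervalIntegral.intervalIntegrable_rpow' ha (a := 1) (b := 0)).comp_sub_left 1
  have h2 : IntervalIntegrable (fun x : ℝ => (1 + x) ^ b) volume (-1) 0 := by
    simpa using (intervalIntegral.intervalIntegrable_rpow' hb (a := 0) (b := 1)).comp_add_left 1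
  -- Each factor of the weight is singular at only one endpoint, so on each half the other factor is
  -- continuous.
  refine IntervalIntegrable.trans (b := 0) ?_ ?_
  · refine h2.continuousOn_mul (g := fun x : ℝ => (1 - x) ^ a) ?_
    refine ContinuousOn.rpow_const (by fun_prop) fun x hx => Or.inl ?_
    rw [uIcc_of_le (by norm_num)] at hx
    have := hx.2
    linarith
  · refine h1.mul_continuousOn (g := fun x : ℝ => (1 + x) ^ b) ?_
    refine ContinuousOn.rpow_const (by fun_prop) fun x hx => Or.inl ?_
    rw [uIcc_of_le (by norm_num)] at hx
    have := hx.1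
    linarith

theorem intervalIntegrable_mul_jacobiWeight {a b : ℝ} (ha : -1 < a) (hb : -1 < b) {f : ℝ → ℝ}
    (hf : Continuous f) :
    IntervalIntegrable (fun x => f x * jacobiWeight a b x) volume (-1) 1 :=
  (intervalIntegrable_jacobiWeight ha hb).continuousOn_mul hf.continuousOn

/-! ### Polynomial integrals against the Jacobi weight -/

/-- The integral of a polynomial against the Jacobi weight. -/
def jacobiIntegral (a b : ℝ) (p : ℝ[X]) : ℝ :=
  ∫ x in (-1 : ℝ)..1, p.eval x * jacobiWeight a b x

section Linear

variable {a b : ℝ} (ha : -1 < a) (hb : -1 < b)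
include ha hb

theorem jacobiIntegral_add (p q : ℝ[X]) :
    jacobiIntegral a b (p + q) = jacobiIntegral a b p + jacobiIntegral a b q := by
  simp only [jacobiIntegral, eval_add, add_mul]
  exact intervalIntegral.integral_add
    (intervalIntegrable_mul_jacobiWeight ha hb p.continuous)
    (intervalIntegrable_mul_jacobiWeight ha hb q.continuous)

end Linear

theorem jacobiIntegral_C_mul (a b c : ℝ) (p : ℝ[X]) :
    jacobiIntegral a b (C c * p) = c * jacobiIntegral a b p := by
  simp only [jacobiIntegral, eval_mul, eval_C, mul_assoc, intervalIntegral.integral_const_mul]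

/-- The endpoints are null, and the power rules used later need `1 - x` and `1 + x` to be nonzero.
-/
theorem jacobiIntegral_congr {a b : ℝ} {p : ℝ[X]} {f : ℝ → ℝ}
    (h : ∀ x ∈ Ioo (-1 : ℝ) 1, p.eval x * jacobiWeight a b x = f x) :
    jacobiIntegral a b p = ∫ x in (-1 : ℝ)..1, f x :=
  intervalIntegral.integral_congr_Ioo_of_le (by norm_num) h

/-- The substitution `x = 2t - 1` produces the beta integral `B(b + 1, a + 1)`. -/
theorem jacobiIntegral_one {a b : ℝ} (ha : -1 < a) (hb : -1 < b) :
    jacobiIntegral a b 1 =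
      2 ^ (a + b + 1) * Real.Gamma (a + 1) * Real.Gamma (b + 1) / Real.Gamma (a + b + 2) := by
  have hB := ProbabilityTheory.beta_eq_betaIntegralReal (b + 1) (a + 1) (by linarith) (by linarith)
  have h2 : (Complex.betaIntegral ((b + 1 : ℝ) : ℂ) ((a + 1 : ℝ) : ℂ)).re =
      ∫ t in (0 : ℝ)..1, t ^ b * (1 - t) ^ a := by
    have : Complex.betaIntegral ((b + 1 : ℝ) : ℂ) ((a + 1 : ℝ) : ℂ) =
        ((∫ t in (0 : ℝ)..1, t ^ b * (1 - t) ^ a : ℝ) : ℂ) := by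
      rw [Complex.betaIntegral, ← intervalIntegral.integral_ofReal]
      refine intervalIntegral.integral_congr_Ioo_of_le (by norm_num) fun t ht => ?_
      have h1 : (0 : ℝ) ≤ t := ht.1.le
      have h2 : (0 : ℝ) ≤ 1 - t := by linarith [ht.2]
      push_cast [Complex.ofReal_cpow h1, Complex.ofReal_cpow h2]
      ring_nf
    rw [this, Complex.ofReal_re]
  have h3 : jacobiIntegral a b 1 = 2 ^ (a + b + 1) * ∫ t in (0 : ℝ)..1, t ^ b * (1 - t) ^ a := by
    have := intervalIntegral.integral_comp_mul_add (a := 0) (b := 1)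
      (fun x => jacobiWeight a b x) (two_ne_zero : (2 : ℝ) ≠ 0) (-1)
    rw [mul_zero, zero_add, mul_one, smul_eq_mul, show (2 : ℝ) + -1 = 1 by norm_num] at this
    have h4 : jacobiIntegral a b 1 = ∫ x in (-1 : ℝ)..1, jacobiWeight a b x := by
      simp [jacobiIntegral]
    rw [h4, ← mul_right_inj' (by norm_num : (2 : ℝ)⁻¹ ≠ 0), ← this, ← mul_assoc,
      ← intervalIntegral.integral_const_mul]
    refine intervalIntegral.integral_congr_Ioo_of_le (by norm_num) fun t ht => ?_
    have h1 : (0 : ℝ) ≤ t := ht.1.le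
    have h2 : (0 : ℝ) ≤ 1 - t := by linarith [ht.2]
    have e1 : 1 - (2 * t + -1) = 2 * (1 - t) := by ring
    have e2 : 1 + (2 * t + -1) = 2 * t := by ring
    simp only [jacobiWeight]
    rw [e1, e2, Real.mul_rpow two_pos.le h1, Real.mul_rpow two_pos.le h2,
      Real.rpow_add two_pos, Real.rpow_add two_pos, Real.rpow_one]
    ring
  rw [h3, ← h2, ← hB, ProbabilityTheory.beta]
  ring_nf

theorem jacobiIntegral_one_sub_sq_mul {a b : ℝ} (p : ℝ[X]) :
    jacobiIntegral a b ((1 - X ^ 2) * p) = jacobiIntegral (a + 1) (b + 1) p := by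
  refine jacobiIntegral_congr fun x hx => ?_
  have h1 : 0 < 1 - x := by linarith [hx.2]
  have h2 : 0 < 1 + x := by linarith [hx.1]
  simp only [jacobiWeight, Real.rpow_add_one h1.ne', Real.rpow_add_one h2.ne', eval_mul, eval_sub,
    eval_one, eval_pow, eval_X]
  ring

/-! ### Rodrigues' formula and integration by parts -/

/-- The polynomial `q` with `((1 - x)^(a+1) (1 + x)^(b+1) p)' = (1 - x)^a (1 + x)^b q`. -/
def jacobiRaise (a b : ℝ) (p : ℝ[X]) : ℝ[X] :=
  C (b + 1) * (1 - X) * p - C (a + 1) * (1 + X) * p + (1 - X ^ 2) * derivative p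

theorem hasDerivAt_jacobiWeight_mul (a b : ℝ) (p : ℝ[X]) {x : ℝ} (hx : x ∈ Ioo (-1 : ℝ) 1) :
    HasDerivAt (fun t => jacobiWeight (a + 1) (b + 1) t * p.eval t)
      (jacobiWeight a b x * (jacobiRaise a b p).eval x) x := by
  have h1 : 0 < 1 - x := by linarith [hx.2]
  have h2 : 0 < 1 + x := by linarith [hx.1]
  have d1 : HasDerivAt (fun t : ℝ => (1 - t) ^ (a + 1)) (-1 * (a + 1) * (1 - x) ^ (a + 1 - 1)) x :=
    ((hasDerivAt_id x).const_sub 1).rpow_const (Or.inl h1.ne')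
  have d2 : HasDerivAt (fun t : ℝ => (1 + t) ^ (b + 1)) (1 * (b + 1) * (1 + x) ^ (b + 1 - 1)) x :=
    ((hasDerivAt_id x).const_add 1).rpow_const (Or.inl h2.ne')
  convert! (d1.mul d2).mul (p.hasDerivAt x) using 1
  simp only [jacobiWeight, jacobiRaise, Real.rpow_add_one h1.ne', Real.rpow_add_one h2.ne',
    eval_mul, eval_sub, eval_add, eval_one, eval_pow, eval_X, eval_C, add_sub_cancel_right,
    Pi.mul_apply]
  ring

/-- The integrand is a derivative, and the boundary values vanish because `a + 1` and `b + 1` are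
positive. -/
theorem jacobiIntegral_jacobiRaise {a b : ℝ} (ha : -1 < a) (hb : -1 < b) (p : ℝ[X]) :
    jacobiIntegral a b (jacobiRaise a b p) = 0 := by
  have key := intervalIntegral.integral_eq_sub_of_hasDerivAt_of_le (a := -1) (b := 1)
    (f := fun t : ℝ => jacobiWeight (a + 1) (b + 1) t * p.eval t) (by norm_num) ?_
    (fun x hx => hasDerivAt_jacobiWeight_mul a b p hx) ?_
  · simp only [mul_comm (jacobiWeight a b _)] at key
    have ha' : a + 1 ≠ 0 := by linarith
    have hb' : b + 1 ≠ 0 := by linarith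
    rw [jacobiIntegral, key]
    simp [jacobiWeight, Real.zero_rpow ha', Real.zero_rpow hb']
  · refine Continuous.continuousOn (Continuous.mul (Continuous.mul ?_ ?_) p.continuous)
    · exact Continuous.rpow_const (by fun_prop) fun x => Or.inr (by linarith)
    · exact Continuous.rpow_const (by fun_prop) fun x => Or.inr (by linarith)
  · simpa only [mul_comm (jacobiWeight a b _)] using
      intervalIntegrable_mul_jacobiWeight ha hb (jacobiRaise a b p).continuous

/-- The polynomial `R` with `((1 - x)^(a+n) (1 + x)^(b+n))^(n) = (1 - x)^a (1 + x)^b R`. -/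
def rodriguesPoly : ℕ → ℝ → ℝ → ℝ[X]
  | 0, _, _ => 1
  | n + 1, a, b => jacobiRaise a b (rodriguesPoly n (a + 1) (b + 1))

theorem iteratedDeriv_jacobiWeight (n : ℕ) (a b : ℝ) {x : ℝ} (hx : x ∈ Ioo (-1 : ℝ) 1) :
    iteratedDeriv n (fun t : ℝ => (1 - t) ^ (a + n) * (1 + t) ^ (b + n)) x =
      jacobiWeight a b x * (rodriguesPoly n a b).eval x := by
  induction n generalizing a b x with
  | zero => simp [rodriguesPoly, jacobiWeight]
  | succ n ih =>
    rw [iteratedDeriv_succ]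
    -- The inductive formula holds only on the open interval, so the last derivative is taken
    -- through an equality of germs.
    have : iteratedDeriv n (fun t : ℝ => (1 - t) ^ (a + (n + 1 : ℕ)) * (1 + t) ^ (b + (n + 1 : ℕ)))
        =ᶠ[nhds x] fun t => jacobiWeight (a + 1) (b + 1) t *
          (rodriguesPoly n (a + 1) (b + 1)).eval t := by
      filter_upwards [isOpen_Ioo.mem_nhds hx] with t ht
      rw [← ih (a + 1) (b + 1) ht]
      congr 1
      ext t
      push_cast
      ring_nf
    rw [this.deriv_eq, (hasDerivAt_jacobiWeight_mul a b _ hx).deriv, rodriguesPoly]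

theorem jacobi_eval_eq (n : ℕ) (a b : ℝ) {x : ℝ} (hx : x ∈ Ioo (-1 : ℝ) 1) :
    (jacobi n a b).eval x = (-1) ^ n / (2 ^ n * n !) * (rodriguesPoly n a b).eval x := by
  have h := jacobi_rodrigues n a b x hx.1 hx.2
  rw [iteratedDeriv_jacobiWeight n a b hx] at h
  have h1 : 0 < 1 - x := by linarith [hx.2]
  have h2 : 0 < 1 + x := by linarith [hx.1]
  have hw : jacobiWeight a b x ≠ 0 := by unfold jacobiWeight; positivity
  apply mul_left_cancel₀ hw
  rw [h]; ring

/-- Integration by parts: `jacobiRaise` obeys a product rule whose extra term is `(1 - X ^ 2) p' R`.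
The total derivative integrates to zero, and `1 - X ^ 2` raises both exponents by one. -/
theorem jacobiIntegral_mul_rodriguesPoly (n : ℕ) {a b : ℝ} (ha : -1 < a) (hb : -1 < b)
    (p : ℝ[X]) :
    jacobiIntegral a b (p * rodriguesPoly n a b) =
      (-1) ^ n * jacobiIntegral (a + n) (b + n) (derivative^[n] p) := by
  induction n generalizing a b p with
  | zero => simp [rodriguesPoly]
  | succ n ih =>
    have e : p * rodriguesPoly (n + 1) a b = jacobiRaise a b (p * rodriguesPoly n (a + 1) (b + 1)) +
        C (-1) * ((1 - X ^ 2) * (derivative p * rodriguesPoly n (a + 1) (b + 1))) := by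
      simp only [rodriguesPoly, jacobiRaise, derivative_mul, C_neg, C_1]
      ring
    rw [e, jacobiIntegral_add ha hb, jacobiIntegral_jacobiRaise ha hb, jacobiIntegral_C_mul,
      jacobiIntegral_one_sub_sq_mul, ih (by linarith) (by linarith), Function.iterate_succ_apply]
    push_cast
    rw [pow_succ, add_right_comm a, add_right_comm b, ← add_assoc a, ← add_assoc b]
    ring

/-- `jacobiRaise a b` sends a top coefficient in degree `n` to `-(a + b + n + 2)` times itself in
degree `n + 1`; this is the `k = 0` factor of the new product. -/
theorem rodriguesPoly_natDegree_le_coeff (n : ℕ) (a b : ℝ) :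
    (rodriguesPoly n a b).natDegree ≤ n ∧
    (rodriguesPoly n a b).coeff n = (-1) ^ n * ∏ k ∈ Finset.range n, (a + b + n + 1 + k) := by
  induction n generalizing a b with
  | zero => simp [rodriguesPoly]
  | succ n ih =>
    obtain ⟨h1, h2⟩ := ih (a + 1) (b + 1)
    set R := rodriguesPoly n (a + 1) (b + 1)
    have e : rodriguesPoly (n + 1) a b =
        C (-(a + b + 2)) * (R * X) + C (b - a) * R + derivative R - derivative R * X * X := by
      simp only [rodriguesPoly, jacobiRaise]
      simp only [C_neg, C_add, C_sub, C_1, C_ofNat]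
      ring
    have hd : (derivative R).natDegree ≤ n - 1 := (natDegree_derivative_le R).trans (by omega)
    have hc : R.coeff (n + 1) = 0 := coeff_eq_zero_of_natDegree_lt (by omega)
    have hc' : R.coeff (n + 1 + 1) = 0 := coeff_eq_zero_of_natDegree_lt (by omega)
    constructor
    · rw [natDegree_le_iff_coeff_eq_zero]
      intro N hN
      obtain ⟨m, rfl⟩ := Nat.exists_eq_add_of_lt hN
      have z : ∀ j, n < j → R.coeff j = 0 := fun j hj => coeff_eq_zero_of_natDegree_lt (by omega)
      rw [e, show n + 1 + m + 1 = (n + m + 1) + 1 by ring]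
      simp only [coeff_sub, coeff_add, coeff_C_mul, coeff_mul_X, coeff_derivative]
      rw [z (n + m + 1) (by omega), z (n + m + 1 + 1) (by omega), z (n + m + 1 + 1 + 1) (by omega)]
      simp
    · rw [e]
      have hx : (derivative R * X * X).coeff (n + 1) = n * R.coeff n := by
        rcases n with - | m
        · simp
        · rw [coeff_mul_X, coeff_mul_X, coeff_derivative]; push_cast; ring
      simp only [coeff_sub, coeff_add, coeff_C_mul, coeff_mul_X, coeff_derivative, hx, hc, hc', h2]
      rw [Finset.prod_range_succ', pow_succ]
      have : ∀ k : ℕ, a + 1 + (b + 1) + (n : ℝ) + 1 + k = a + b + (n + 1 : ℕ) + 1 + (k + 1 : ℕ) := by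
        intro k; push_cast; ring
      simp only [this]
      push_cast
      ring

theorem jacobiIntegral_mul_jacobi (n : ℕ) {a b : ℝ} (ha : -1 < a) (hb : -1 < b) (p : ℝ[X]) :
    jacobiIntegral a b (p * jacobi n a b) =
      1 / (2 ^ n * n !) * jacobiIntegral (a + n) (b + n) (derivative^[n] p) := by
  have h1 : jacobiIntegral a b (p * jacobi n a b) =
      jacobiIntegral a b (C ((-1) ^ n / (2 ^ n * n !) : ℝ) * (p * rodriguesPoly n a b)) := by
    refine jacobiIntegral_congr fun x hx => ?_
    rw [eval_mul, jacobi_eval_eq n a b hx, eval_mul, eval_C, eval_mul]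
    ring
  rw [h1, jacobiIntegral_C_mul, jacobiIntegral_mul_rodriguesPoly n ha hb]
  have : ((-1 : ℝ) ^ n) * (-1) ^ n = 1 := by rw [← mul_pow]; norm_num
  linear_combination (1 / (2 ^ n * n ! : ℝ) *
    jacobiIntegral (a + n) (b + n) (derivative^[n] p)) * this

theorem iterate_derivative_of_natDegree_le {n : ℕ} {p : ℝ[X]} (hp : p.natDegree ≤ n) :
    derivative^[n] p = C (n ! * p.coeff n) := by
  ext m
  rw [coeff_iterate_derivative, coeff_C]
  split_ifs with h
  · subst h; simp [Nat.descFactorial_self]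
  · rw [coeff_eq_zero_of_natDegree_lt (by omega), smul_zero]

theorem jacobiIntegral_C (a b c : ℝ) : jacobiIntegral a b (C c) = c * jacobiIntegral a b 1 := by
  rw [← jacobiIntegral_C_mul, mul_one]

theorem jacobiIntegral_mul_jacobi_of_natDegree_le {n : ℕ} {a b : ℝ} (ha : -1 < a) (hb : -1 < b)
    {p : ℝ[X]} (hp : p.natDegree ≤ n) :
    jacobiIntegral a b (p * jacobi n a b) =
      p.coeff n / 2 ^ n * jacobiIntegral (a + n) (b + n) 1 := by
  rw [jacobiIntegral_mul_jacobi n ha hb, iterate_derivative_of_natDegree_le hp, jacobiIntegral_C]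
  have : (n ! : ℝ) ≠ 0 := by positivity
  field_simp

theorem jacobiIntegral_mul_jacobi_of_natDegree_lt {n : ℕ} {a b : ℝ} (ha : -1 < a) (hb : -1 < b)
    {p : ℝ[X]} (hp : p.natDegree < n) : jacobiIntegral a b (p * jacobi n a b) = 0 := by
  rw [jacobiIntegral_mul_jacobi_of_natDegree_le ha hb hp.le, coeff_eq_zero_of_natDegree_lt hp]
  simp

/-! ### The normalization `γ_n` and the first moment -/

theorem prod_mul_Gamma {x : ℝ} (hx : 0 < x) (m : ℕ) :
    (∏ k ∈ Finset.range m, (x + k)) * Real.Gamma x = Real.Gamma (x + m) := by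
  induction m with
  | zero => simp
  | succ m ih =>
    rw [Finset.prod_range_succ, mul_right_comm, ih, Nat.cast_succ, ← add_assoc,
      Real.Gamma_add_one (by positivity), mul_comm]

/-- For `n = 0` the product is empty and the two Gamma values coincide, so a nonpositive argument
does no harm; for `n ≥ 1` the argument is positive. -/
theorem prod_mul_Gamma_eq {n : ℕ} {a b : ℝ} (ha : -1 < a) (hb : -1 < b) :
    (∏ k ∈ Finset.range n, (a + b + n + 1 + k)) * Real.Gamma (n + a + b + 1) =
      Real.Gamma (2 * n + a + b + 1) := by
  rcases n with - | n
  · simp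
  · have h : 0 < a + b + (n + 1 : ℕ) + 1 := by
      push_cast
      have : (0 : ℝ) ≤ n := n.cast_nonneg
      linarith
    rw [show ((n + 1 : ℕ) : ℝ) + a + b + 1 = a + b + (n + 1 : ℕ) + 1 by ring, prod_mul_Gamma h]
    congr 1; ring

theorem prod_pos_of_neg_one_lt (n : ℕ) {a b : ℝ} (ha : -1 < a) (hb : -1 < b) :
    0 < ∏ k ∈ Finset.range n, (a + b + n + 1 + k) := by
  refine Finset.prod_pos fun k hk => ?_
  have h1 : (1 : ℝ) ≤ n := by
    have := Finset.mem_range.mp hk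
    exact_mod_cast (by omega : 1 ≤ n)
  have : (0 : ℝ) ≤ k := k.cast_nonneg
  linarith

theorem jacobiIntegral_one_pos {a b : ℝ} (ha : -1 < a) (hb : -1 < b) :
    0 < jacobiIntegral a b 1 := by
  rw [jacobiIntegral_one ha hb]
  have h1 := Real.Gamma_pos_of_pos (by linarith : 0 < a + 1)
  have h2 := Real.Gamma_pos_of_pos (by linarith : 0 < b + 1)
  have h3 := Real.Gamma_pos_of_pos (by linarith : 0 < a + b + 2)
  positivity

theorem neg_one_lt_add_natCast {a : ℝ} (ha : -1 < a) (n : ℕ) : -1 < a + n := by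
  have : (0 : ℝ) ≤ n := n.cast_nonneg
  linarith

/-- This form avoids `Γ(n + a + b + 1)`, hence the exceptional case `n = 0`, `a + b = -1`, and makes
positivity evident. -/
theorem jacobiGamma_eq_prod_mul (n : ℕ) {a b : ℝ} (ha : -1 < a) (hb : -1 < b) :
    jacobiGamma n a b = (∏ k ∈ Finset.range n, (a + b + n + 1 + k)) / (4 ^ n * n !) *
      jacobiIntegral (a + n) (b + n) 1 := by
  rw [jacobiIntegral_one (neg_one_lt_add_natCast ha n) (neg_one_lt_add_natCast hb n)]
  rcases n with - | n
  · simp [jacobiGamma]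
  · set N := n + 1 with hN
    have hN1 : (1 : ℝ) ≤ N := by simp [hN]
    have hG := prod_mul_Gamma_eq (n := N) ha hb
    have hpos := prod_pos_of_neg_one_lt N ha hb
    rw [jacobiGamma_eq N a b (Or.inl (by omega))]
    have g1 : Real.Gamma (N + a + b + 1) ≠ 0 := (Real.Gamma_pos_of_pos (by linarith)).ne'
    have g3 : (2 * N + a + b + 1 : ℝ) ≠ 0 := by linarith
    have e : a + N + (b + N) + 2 = (2 * N + a + b + 1 : ℝ) + 1 := by ring
    rw [e, Real.Gamma_add_one g3, ← hG]
    have e2 : (2 : ℝ) ^ (a + N + (b + N) + 1) = 2 ^ (a + b + 1) * 4 ^ N := by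
      rw [show a + N + (b + N) + 1 = (a + b + 1) + ((2 * N : ℕ) : ℝ) by push_cast; ring,
        Real.rpow_add two_pos, Real.rpow_natCast, pow_mul]
      norm_num
    rw [e2, show (N + a + 1 : ℝ) = a + N + 1 by ring, show (N + b + 1 : ℝ) = b + N + 1 by ring]
    field_simp

theorem jacobiGamma_pos (n : ℕ) {a b : ℝ} (ha : -1 < a) (hb : -1 < b) : 0 < jacobiGamma n a b := by
  rw [jacobiGamma_eq_prod_mul n ha hb]
  have h1 := prod_pos_of_neg_one_lt n ha hb
  have h2 := jacobiIntegral_one_pos (neg_one_lt_add_natCast ha n) (neg_one_lt_add_natCast hb n)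
  positivity

/-- With one factor written through `rodriguesPoly`, only its coefficient of degree `n` survives the
pairing with the other. -/
theorem jacobiIntegral_jacobi_mul_self (n : ℕ) {a b : ℝ} (ha : -1 < a) (hb : -1 < b) :
    jacobiIntegral a b (jacobi n a b * jacobi n a b) = jacobiGamma n a b := by
  have h1 : jacobiIntegral a b (jacobi n a b * jacobi n a b) =
      jacobiIntegral a b (C ((-1) ^ n / (2 ^ n * n !) : ℝ) * (rodriguesPoly n a b * jacobi n a b)) := by
    refine jacobiIntegral_congr fun x hx => ?_
    rw [eval_mul, eval_mul, eval_mul, jacobi_eval_eq n a b hx, eval_C]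
    ring
  obtain ⟨hd, hc⟩ := rodriguesPoly_natDegree_le_coeff n a b
  rw [h1, jacobiIntegral_C_mul, jacobiIntegral_mul_jacobi_of_natDegree_le ha hb hd, hc,
    jacobiGamma_eq_prod_mul n ha hb]
  have h2 : ((-1 : ℝ) ^ n) * (-1) ^ n = 1 := by rw [← mul_pow]; norm_num
  have h4 : (4 : ℝ) ^ n = 2 ^ n * 2 ^ n := by rw [← mul_pow]; norm_num
  rw [h4]
  linear_combination ((∏ k ∈ Finset.range n, (a + b + n + 1 + k)) / (2 ^ n * 2 ^ n * n !) *
      jacobiIntegral (a + n) (b + n) 1) * h2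

theorem jacobiIntegral_one_eq_jacobiGamma {a b : ℝ} (ha : -1 < a) (hb : -1 < b) :
    jacobiIntegral a b 1 = jacobiGamma 0 a b := by
  simp [jacobiGamma_eq_prod_mul 0 ha hb]

theorem jacobiIntegral_X {a b : ℝ} (ha : -1 < a) (hb : -1 < b) :
    jacobiIntegral a b X = (b - a) / (a + b + 2) * jacobiIntegral a b 1 := by
  have h := jacobiIntegral_jacobiRaise ha hb 1
  have e : jacobiRaise a b 1 = C (b - a) + C (-(a + b + 2)) * X := by
    simp only [jacobiRaise, C_neg, C_add, C_sub, C_1, C_ofNat, derivative_one]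
    ring
  rw [e, jacobiIntegral_add ha hb, jacobiIntegral_C_mul, jacobiIntegral_C] at h
  have : a + b + 2 ≠ 0 := by linarith
  field_simp
  linarith

/-! ### Closed forms of `σ_{n,0}` and `σ_{n,1}` -/

theorem sigma_eq_jacobiIntegral (n j : ℕ) (a b : ℝ) :
    sigma n j a b = 1 / jacobiGamma n a b *
      jacobiIntegral a b (Chebyshev.U ℝ (n + j) * jacobi n a b) := by
  simp only [sigma, jacobiIntegral, eval_mul]

theorem coeff_U_natCast (n : ℕ) : (Chebyshev.U ℝ n).coeff n = 2 ^ n := by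
  have := Chebyshev.leadingCoeff_U_natCast ℝ n
  rwa [leadingCoeff, Chebyshev.natDegree_U_natCast] at this

theorem coeff_U_natCast_add_one (n : ℕ) : (Chebyshev.U ℝ (n + 1)).coeff n = 0 := by
  induction n with
  | zero => simp
  | succ n ih =>
    have e : Chebyshev.U ℝ ((n + 1 : ℕ) + 1) =
        C 2 * (Chebyshev.U ℝ (n + 1) * X) - Chebyshev.U ℝ n := by
      push_cast
      rw [add_assoc, one_add_one_eq_two, Chebyshev.U_add_two, C_ofNat]
      ring
    rw [e, coeff_sub, coeff_C_mul, coeff_mul_X, ih,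
      coeff_eq_zero_of_natDegree_lt (by rw [Chebyshev.natDegree_U_natCast]; omega)]
    simp

/-- By parity `U_{n+1}` has no term of degree `n`, so no constant remains. Thus `σ_{n,1}` reduces to
the first moment of the raised weight. -/
theorem iterate_derivative_U_natCast_add_one (n : ℕ) :
    derivative^[n] (Chebyshev.U ℝ (n + 1)) = C (2 ^ (n + 1) * (n + 1)! : ℝ) * X := by
  ext m
  rw [coeff_iterate_derivative, coeff_C_mul, coeff_X]
  have hU := coeff_U_natCast (n + 1)
  have hd := Chebyshev.natDegree_U_natCast ℝ (n + 1)
  push_cast at hU hd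
  rcases m with - | m
  · rw [zero_add, coeff_U_natCast_add_one]; simp
  · split_ifs with h
    · obtain rfl : m = 0 := by omega
      rw [zero_add, add_comm 1 n, hU]
      have := Nat.factorial_mul_descFactorial (show n ≤ n + 1 by omega)
      rw [Nat.add_sub_cancel_left, Nat.factorial_one, one_mul] at this
      rw [this, nsmul_eq_mul]
      ring
    · rw [coeff_eq_zero_of_natDegree_lt (by rw [hd]; omega), smul_zero, mul_zero]

theorem sigma_zero_eq_div (n : ℕ) {a b : ℝ} (ha : -1 < a) (hb : -1 < b) :
    sigma n 0 a b = 1 / jacobiGamma n a b * jacobiIntegral (a + n) (b + n) 1 := by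
  rw [sigma_eq_jacobiIntegral, Nat.cast_zero, add_zero,
    jacobiIntegral_mul_jacobi_of_natDegree_le ha hb (Chebyshev.natDegree_U_natCast ℝ n).le,
    coeff_U_natCast, div_self (by positivity), one_mul]

theorem sigma_zero_eq (n : ℕ) {a b : ℝ} (ha : -1 < a) (hb : -1 < b) :
    sigma n 0 a b = 4 ^ n * n ! / ∏ k ∈ Finset.range n, (a + b + n + 1 + k) := by
  have h1 := prod_pos_of_neg_one_lt n ha hb
  have h2 := jacobiIntegral_one_pos (neg_one_lt_add_natCast ha n) (neg_one_lt_add_natCast hb n)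
  rw [sigma_zero_eq_div n ha hb, jacobiGamma_eq_prod_mul n ha hb]
  field_simp

/-- Legendre's duplication formula at `n + 1`. -/
theorem sqrt_pi_mul_factorial_div_Gamma (n : ℕ) :
    √Real.pi / 2 * ((2 * n + 1)! / Real.Gamma (n + 3 / 2)) = 4 ^ n * n ! := by
  have h := Real.Gamma_mul_Gamma_add_half (n + 1)
  rw [Real.Gamma_nat_eq_factorial, show (n : ℝ) + 1 + 1 / 2 = n + 3 / 2 by ring,
    show 2 * ((n : ℝ) + 1) = ((2 * n + 1 : ℕ) : ℝ) + 1 by push_cast; ring,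
    Real.Gamma_nat_eq_factorial] at h
  have e : (2 : ℝ) ^ (1 - (((2 * n + 1 : ℕ) : ℝ) + 1)) = (2 * 4 ^ n)⁻¹ := by
    rw [show 1 - (((2 * n + 1 : ℕ) : ℝ) + 1) = -((2 * n + 1 : ℕ) : ℝ) by ring,
      Real.rpow_neg two_pos.le, Real.rpow_natCast, pow_succ, pow_mul]
    norm_num
    ring
  rw [e] at h
  have hG : Real.Gamma (n + 3 / 2 : ℝ) ≠ 0 := (Real.Gamma_pos_of_pos (by positivity)).ne'
  field_simp at h ⊢
  linarith

theorem sigma_zero_eq_Gamma {n : ℕ} {a b : ℝ} (ha : -1 < a) (hb : -1 < b)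
    (h : n ≠ 0 ∨ a + b + 1 ≠ 0) :
    sigma n 0 a b = √Real.pi / 2 * ((2 * n + 1)! * Real.Gamma (n + a + b + 1) /
          (Real.Gamma (n + 3 / 2) * Real.Gamma (2 * n + a + b + 1))) := by
  have hG : Real.Gamma (n + a + b + 1) ≠ 0 := by
    -- As `a + b > -2`, the argument can be a nonpositive integer only if `n = 0` and `a + b + 1 =
    -- 0`.
    refine Real.Gamma_ne_zero fun m hm => ?_
    rcases n with - | n
    · rcases m with - | m
      · simp at h hm
        exact h hm
      · push_cast at hm
        have : (0 : ℝ) ≤ m := m.cast_nonneg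
        linarith
    · push_cast at hm
      have : (0 : ℝ) ≤ m := m.cast_nonneg
      have : (0 : ℝ) ≤ n := n.cast_nonneg
      linarith
  have hP := prod_pos_of_neg_one_lt n ha hb
  rw [← prod_mul_Gamma_eq ha hb, sigma_zero_eq n ha hb, ← sqrt_pi_mul_factorial_div_Gamma n]
  have hG' : Real.Gamma (n + 3 / 2 : ℝ) ≠ 0 := (Real.Gamma_pos_of_pos (by positivity)).ne'
  field_simp

theorem sigma_one_eq (n : ℕ) {a b : ℝ} (ha : -1 < a) (hb : -1 < b) :
    sigma n 1 a b = (b - a) * (2 * n + 2) / (2 * n + a + b + 2) * sigma n 0 a b := by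
  rw [sigma_zero_eq_div n ha hb, sigma_eq_jacobiIntegral, Nat.cast_one,
    jacobiIntegral_mul_jacobi n ha hb, iterate_derivative_U_natCast_add_one, jacobiIntegral_C_mul,
    jacobiIntegral_X (neg_one_lt_add_natCast ha n) (neg_one_lt_add_natCast hb n),
    Nat.factorial_succ, show a + n + (b + n) + 2 = 2 * n + a + b + 2 by ring]
  have : (n ! : ℝ) ≠ 0 := by positivity
  push_cast
  field_simp
  ring

/-! ### Jacobi coefficients of the Chebyshev polynomials `T_k` -/

/-- The coefficients `(1/γ_n) ∫ T_k J_n ω` of the Chebyshev polynomials of the first kind. -/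
def chebyshevJacobi (n k : ℕ) (a b : ℝ) : ℝ :=
  1 / jacobiGamma n a b * jacobiIntegral a b (Chebyshev.T ℝ k * jacobi n a b)

theorem chebyshevJacobi_of_lt {n k : ℕ} (h : k < n) {a b : ℝ} (ha : -1 < a) (hb : -1 < b) :
    chebyshevJacobi n k a b = 0 := by
  rw [chebyshevJacobi, jacobiIntegral_mul_jacobi_of_natDegree_lt ha hb, mul_zero]
  simpa [Chebyshev.natDegree_T] using h

/-- In `2 T_k = U_k - U_{k-2}` the second term is orthogonal to `J_n`, because `n + j - 2 < n`. The
index `0` is excluded since `T_0 = U_0` without the factor `2`. -/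
theorem two_mul_chebyshevJacobi_add {n j : ℕ} (hj : j < 2) (hnj : n + j ≠ 0) {a b : ℝ}
    (ha : -1 < a) (hb : -1 < b) : 2 * chebyshevJacobi n (n + j) a b = sigma n j a b := by
  rw [chebyshevJacobi, sigma_eq_jacobiIntegral, mul_left_comm, ← jacobiIntegral_C_mul, C_ofNat,
    ← mul_assoc]
  congr 1
  rcases h : n + j with - | k
  · exact absurd h hnj
  rw [show (n : ℤ) + j = ((k + 1 : ℕ) : ℤ) by rw [← h]; push_cast; ring]
  rcases k with - | k
  · simp
  · push_cast
    rw [add_assoc, one_add_one_eq_two, Chebyshev.two_mul_T_eq_U_sub_U, sub_eq_add_neg, add_mul,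
      jacobiIntegral_add ha hb, ← neg_one_mul, ← C_1, ← C_neg, mul_assoc, jacobiIntegral_C_mul,
      jacobiIntegral_mul_jacobi_of_natDegree_lt ha hb (p := Chebyshev.U ℝ k), mul_zero,
      add_zero]
    rw [Chebyshev.natDegree_U_natCast]
    omega

theorem chebyshevJacobi_zero_zero {a b : ℝ} : chebyshevJacobi 0 0 a b = sigma 0 0 a b := by
  simp [chebyshevJacobi, sigma_eq_jacobiIntegral]

theorem integral_abs_jacobi_le (n : ℕ) {a b : ℝ} (ha : -1 < a) (hb : -1 < b) :
    ∫ x in (-1 : ℝ)..1, |(jacobi n a b).eval x| * jacobiWeight a b x ≤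
      √(jacobiGamma 0 a b * jacobiGamma n a b) := by
  have h0 := jacobiGamma_pos 0 ha hb
  have hn := jacobiGamma_pos n ha hb
  -- Cauchy–Schwarz via the pointwise bound `|y| ≤ t y² / 2 + 1 / (2t)`; this `t` minimizes the
  -- integrated right-hand side.
  set t := √(jacobiGamma 0 a b) / √(jacobiGamma n a b) with ht
  have htpos : 0 < t := by positivity
  have hle : ∫ x in (-1 : ℝ)..1, |(jacobi n a b).eval x| * jacobiWeight a b x ≤
      jacobiIntegral a b (C (t / 2) * (jacobi n a b * jacobi n a b) + C (1 / (2 * t)) * 1) := by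
    refine intervalIntegral.integral_mono_on (by norm_num)
      (intervalIntegrable_mul_jacobiWeight ha hb (jacobi n a b).continuous.abs)
      (intervalIntegrable_mul_jacobiWeight ha hb (Polynomial.continuous _)) fun x hx => ?_
    have h1 : 0 ≤ 1 - x := by linarith [hx.2]
    have h2 : 0 ≤ 1 + x := by linarith [hx.1]
    refine mul_le_mul_of_nonneg_right ?_ (by unfold jacobiWeight; positivity)
    simp only [eval_add, eval_mul, eval_C, mul_one]
    set y := (jacobi n a b).eval x
    rw [← abs_mul_abs_self y]
    have : t / 2 * (|y| * |y|) + 1 / (2 * t) - |y| = (t * |y| - 1) ^ 2 / (2 * t) := by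
      field_simp; ring
    have : 0 ≤ (t * |y| - 1) ^ 2 / (2 * t) := by positivity
    linarith
  refine hle.trans_eq ?_
  rw [jacobiIntegral_add ha hb, jacobiIntegral_C_mul, jacobiIntegral_C_mul,
    jacobiIntegral_jacobi_mul_self n ha hb, jacobiIntegral_one_eq_jacobiGamma ha hb,
    Real.sqrt_mul h0.le, ht]
  have e0 := Real.sq_sqrt h0.le
  have en := Real.sq_sqrt hn.le
  have p0 := Real.sqrt_pos.mpr h0
  have pn := Real.sqrt_pos.mpr hn
  set s := √(jacobiGamma 0 a b)
  set r := √(jacobiGamma n a b)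
  rw [← e0, ← en]
  field_simp
  ring

theorem abs_chebyshevJacobi_le (n k : ℕ) {a b : ℝ} (ha : -1 < a) (hb : -1 < b) :
    |chebyshevJacobi n k a b| ≤ √(jacobiGamma 0 a b / jacobiGamma n a b) := by
  have h0 := jacobiGamma_pos 0 ha hb
  have hn := jacobiGamma_pos n ha hb
  have h1 : |jacobiIntegral a b (Chebyshev.T ℝ k * jacobi n a b)| ≤
      ∫ x in (-1 : ℝ)..1, |(jacobi n a b).eval x| * jacobiWeight a b x := by
    rw [← Real.norm_eq_abs]
    refine (intervalIntegral.norm_integral_le_integral_norm (by norm_num)).trans ?_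
    refine intervalIntegral.integral_mono_on (by norm_num)
      (intervalIntegrable_mul_jacobiWeight ha hb (Polynomial.continuous _)).norm
      (intervalIntegrable_mul_jacobiWeight ha hb (jacobi n a b).continuous.abs) fun x hx => ?_
    have h1 : 0 ≤ 1 - x := by linarith [hx.2]
    have h2 : 0 ≤ 1 + x := by linarith [hx.1]
    have hw : 0 ≤ jacobiWeight a b x := by unfold jacobiWeight; positivity
    rw [Real.norm_eq_abs, abs_mul, abs_of_nonneg hw, eval_mul, abs_mul]
    refine mul_le_mul_of_nonneg_right ?_ hw
    exact mul_le_of_le_one_left (abs_nonneg _)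
      (Chebyshev.abs_eval_T_real_le_one k (abs_le.mpr hx))
  rw [chebyshevJacobi, abs_mul, abs_of_pos (by positivity), Real.sqrt_div h0.le]
  have h2 := h1.trans (integral_abs_jacobi_le n ha hb)
  rw [Real.sqrt_mul h0.le] at h2
  have pn := Real.sqrt_pos.mpr hn
  calc _ ≤ 1 / jacobiGamma n a b * (√(jacobiGamma 0 a b) * √(jacobiGamma n a b)) := by gcongr
    _ = _ := by
      have en := Real.sq_sqrt hn.le
      set r := √(jacobiGamma n a b)
      rw [← en]
      field_simp

theorem rodriguesPoly_comp_neg_X (n : ℕ) (a : ℝ) :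
    (rodriguesPoly n a a).comp (-X) = C ((-1) ^ n) * rodriguesPoly n a a := by
  induction n generalizing a with
  | zero => simp [rodriguesPoly]
  | succ n ih =>
    have h := ih (a + 1)
    have hd : (derivative (rodriguesPoly n (a + 1) (a + 1))).comp (-X) =
        -(C ((-1) ^ n) * derivative (rodriguesPoly n (a + 1) (a + 1))) := by
      have := congrArg derivative h
      rw [derivative_comp, derivative_C_mul] at this
      rw [← this]
      simp
    simp only [rodriguesPoly, jacobiRaise, sub_comp, add_comp, mul_comp, C_comp, X_comp, one_comp,
      pow_comp, h, hd]
    rw [pow_succ (-1 : ℝ), mul_neg_one, C_neg]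
    ring

/-- With equal exponents the weight is even, while `T_{n+k}` and `J_n` have opposite parities, so
the integrand is odd. -/
theorem chebyshevJacobi_of_odd (n k : ℕ) (hk : Odd k) (a : ℝ) :
    chebyshevJacobi n (n + k) a a = 0 := by
  set f : ℝ → ℝ := fun x => (Chebyshev.T ℝ (n + k : ℕ) * rodriguesPoly n a a).eval x *
    jacobiWeight a a x with hf
  have h1 : jacobiIntegral a a (Chebyshev.T ℝ (n + k : ℕ) * jacobi n a a) =
      (-1) ^ n / (2 ^ n * n !) * ∫ x in (-1 : ℝ)..1, f x := by
    rw [← intervalIntegral.integral_const_mul]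
    refine jacobiIntegral_congr fun x hx => ?_
    simp only [hf]
    rw [eval_mul, jacobi_eval_eq n a a hx, eval_mul]
    ring
  have hodd : ∀ x, f (-x) = -f x := by
    intro x
    have hR : (rodriguesPoly n a a).eval (-x) = (-1) ^ n * (rodriguesPoly n a a).eval x := by
      have := congrArg (eval x) (rodriguesPoly_comp_neg_X n a)
      simpa [eval_comp] using this
    have hw : jacobiWeight a a (-x) = jacobiWeight a a x := by
      simp only [jacobiWeight, sub_neg_eq_add, ← sub_eq_add_neg]
      ring
    simp only [hf]
    rw [eval_mul, hR, hw, Chebyshev.T_eval_neg, eval_mul]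
    have h2 : (((((n + k : ℕ) : ℤ).negOnePow : ℤˣ) : ℤ) : ℝ) = -(-1) ^ n := by
      rw [Int.negOnePow_def, zpow_natCast, pow_add, hk.neg_one_pow]
      simp
    have h3 : ((-1 : ℝ) ^ n) * (-1) ^ n = 1 := by rw [← mul_pow]; norm_num
    rw [h2]
    linear_combination (-((Chebyshev.T ℝ (n + k : ℕ)).eval x * (rodriguesPoly n a a).eval x *
      jacobiWeight a a x)) * h3
  have h2 : ∫ x in (-1 : ℝ)..1, f x = 0 := by
    have h3 := intervalIntegral.integral_comp_neg (a := -1) (b := 1) f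
    simp only [hodd, neg_neg, intervalIntegral.integral_neg] at h3
    linarith
  rw [chebyshevJacobi, h1, h2, mul_zero, mul_zero]

/-! ### Chebyshev expansion of an analytic function -/

/-- The circle `|w| = r` maps to the ellipse with semi-axes `(r ± r⁻¹) / 2`, and both increase with
`r ≥ 1`. -/
theorem joukowski_mem_bernsteinRegion {ρ : ℝ} (hρ : 1 < ρ) {w : ℂ} (h1 : 1 ≤ ‖w‖) (h2 : ‖w‖ ≤ ρ) :
    (w + w⁻¹) / 2 ∈ bernsteinRegion ρ := by
  set r := ‖w‖ with hr
  have hr0 : 0 < r := by linarith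
  have hρ0 : 0 < ρ := by linarith
  have hsq : Complex.normSq w = r ^ 2 := Complex.normSq_eq_norm_sq w
  have hcs : (w.re / r) ^ 2 + (w.im / r) ^ 2 = 1 := by
    rw [Complex.normSq_apply] at hsq
    field_simp
    linarith
  have hre : ((w + w⁻¹) / 2).re = (r + r⁻¹) / 2 * (w.re / r) := by
    simp only [Complex.div_ofNat_re, Complex.add_re, Complex.inv_re, hsq]
    field_simp
  have him : ((w + w⁻¹) / 2).im = (r - r⁻¹) / 2 * (w.im / r) := by
    simp only [Complex.div_ofNat_im, Complex.add_im, Complex.inv_im, hsq]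
    field_simp
    ring
  have hinv : ρ⁻¹ < 1 := inv_lt_one_of_one_lt₀ hρ
  have hinv0 : 0 < ρ⁻¹ := by positivity
  have hrinv : r⁻¹ ≤ 1 := inv_le_one_of_one_le₀ h1
  have hle : ρ⁻¹ ≤ r⁻¹ := inv_anti₀ hr0 h2
  have ha : r + r⁻¹ ≤ ρ + ρ⁻¹ := by
    have e : ρ + ρ⁻¹ - (r + r⁻¹) = (ρ - r) * (1 - ρ⁻¹ * r⁻¹) := by
      field_simp
      ring
    have h3 : ρ⁻¹ * r⁻¹ ≤ 1 := mul_le_one₀ hinv.le (by positivity) hrinv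
    have := mul_nonneg (sub_nonneg.mpr h2) (sub_nonneg.mpr h3)
    linarith
  have key : ∀ {p q s : ℝ}, 0 ≤ p → p ≤ q → 0 < q → (p / 2 * s / (q / 2)) ^ 2 ≤ s ^ 2 := by
    intro p q s hp hpq hq
    have e : (p / 2 * s / (q / 2)) ^ 2 = (p / q) ^ 2 * s ^ 2 := by field_simp
    rw [e]
    exact mul_le_of_le_one_left (sq_nonneg s)
      (pow_le_one₀ (by positivity) ((div_le_one hq).mpr hpq))
  rw [bernsteinRegion, mem_ofPred_eq, hre, him, ← hcs]
  exact add_le_add (key (by positivity) ha (by positivity))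
    (key (by linarith) (by linarith) (by linarith))

/-- The integrand is holomorphic on the annulus `1 ≤ |w| ≤ ρ`, so the contour moves to `|w| = ρ`,
where `|u| ≤ M`. The integral is the `n`-th Fourier coefficient of `u (cos θ)`. -/
theorem norm_joukowski_circleIntegral_le {ρ : ℝ} (hρ : 1 < ρ) {u : ℂ → ℂ}
    (hu : AnalyticOnNhd ℂ u (bernsteinRegion ρ)) {M : ℝ}
    (hM : ∀ z ∈ bernsteinEllipse ρ, ‖u z‖ ≤ M) (n : ℕ) :
    ‖(2 * Real.pi * Complex.I : ℂ)⁻¹ • ∮ w in C(0, 1), (w ^ (n + 1))⁻¹ * u ((w + w⁻¹) / 2)‖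
      ≤ M / ρ ^ n := by
  have hρ0 : 0 < ρ := by linarith
  have hd : ∀ w : ℂ, 1 ≤ ‖w‖ → ‖w‖ ≤ ρ →
      DifferentiableAt ℂ (fun w : ℂ => (w ^ (n + 1))⁻¹ * u ((w + w⁻¹) / 2)) w := by
    intro w h1 h2
    have hw : w ≠ 0 := norm_pos_iff.mp (by linarith)
    have hz := (hu _ (joukowski_mem_bernsteinRegion hρ h1 h2)).differentiableAt
    refine ((differentiableAt_id.pow _).inv (pow_ne_zero _ hw)).mul ?_
    exact hz.comp w ((differentiableAt_id.add (differentiableAt_inv hw)).div_const 2)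
  rw [← Complex.circleIntegral_eq_of_differentiable_on_annulus_off_countable one_pos hρ.le
    countable_empty]
  · refine (circleIntegral.norm_two_pi_i_inv_smul_integral_le_of_norm_le_const (C := M / ρ ^ (n + 1))
      hρ0.le fun w hw => ?_).trans_eq ?_
    · have hw' : ‖w‖ = ρ := by simpa using hw
      rw [norm_mul, norm_inv, norm_pow, hw', inv_mul_eq_div]
      have := hM _ ⟨w, hw', rfl⟩
      gcongr
    · rw [pow_succ]
      field_simp
  · intro w hw
    simp only [mem_sdiff, Metric.mem_closedBall, Metric.mem_ball, dist_zero_right, not_lt] at hw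
    exact (hd w hw.2 hw.1).continuousAt.continuousWithinAt
  · intro w hw
    simp only [mem_sdiff, Metric.mem_closedBall, Metric.mem_ball, dist_zero_right, not_le,
      mem_empty_iff_false, not_false_eq_true, and_true] at hw
    exact hd w hw.2.le hw.1.le

instance fact_two_pi_pos : Fact (0 < 2 * Real.pi) := ⟨Real.two_pi_pos⟩

theorem fourierCoeff_neg_of_even {f : AddCircle (2 * Real.pi) → ℂ} (hf : ∀ t, f (-t) = f t)
    (n : ℤ) : fourierCoeff f (-n) = fourierCoeff f n := by
  rw [fourierCoeff, fourierCoeff, ← integral_neg_eq_self]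
  refine integral_congr_ae (Filter.Eventually.of_forall fun t => ?_)
  simp [hf, fourier_apply]

/-- An analytic function on the closed region bounded by the Bernstein ellipse has a Chebyshev
expansion with geometrically decaying coefficients. -/
theorem exists_chebyshev_expansion {ρ : ℝ} (hρ : 1 < ρ) {u : ℂ → ℂ}
    (hu : AnalyticOnNhd ℂ u (bernsteinRegion ρ)) {M : ℝ}
    (hM : ∀ z ∈ bernsteinEllipse ρ, ‖u z‖ ≤ M) :
    ∃ a : ℕ → ℂ, ‖a 0‖ ≤ M ∧ (∀ k, ‖a k‖ ≤ 2 * (M / ρ ^ k)) ∧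
      ∀ x ∈ Icc (-1 : ℝ) 1, HasSum (fun k => a k * ((Chebyshev.T ℝ k).eval x : ℝ)) (u x) := by
  have hρ0 : 0 < ρ := by linarith
  have hmem : ∀ θ : AddCircle (2 * Real.pi),
      ((AddCircle.toCircle θ : ℂ) + (AddCircle.toCircle θ : ℂ)⁻¹) / 2 ∈ bernsteinRegion ρ :=
    fun θ => joukowski_mem_bernsteinRegion hρ (Circle.norm_coe _).ge
      ((Circle.norm_coe _).le.trans hρ.le)
  let F : C(AddCircle (2 * Real.pi), ℂ) :=
    ⟨fun θ => u (((AddCircle.toCircle θ : ℂ) + (AddCircle.toCircle θ : ℂ)⁻¹) / 2), by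
      have h1 : Continuous fun θ : AddCircle (2 * Real.pi) => (AddCircle.toCircle θ : ℂ) :=
        continuous_subtype_val.comp AddCircle.continuous_toCircle
      refine hu.continuousOn.comp_continuous ?_ hmem
      exact (h1.add (h1.inv₀ fun θ => Circle.coe_ne_zero _)).div_const 2⟩
  have hFapp : ∀ θ, F θ = u (((AddCircle.toCircle θ : ℂ) + (AddCircle.toCircle θ : ℂ)⁻¹) / 2) :=
    fun θ => rfl
  have hFeven : ∀ θ, F (-θ) = F θ := by
    intro θ
    rw [hFapp, hFapp, AddCircle.toCircle_neg, Circle.coe_inv, inv_inv, add_comm]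
  have hcirc : ∀ x : ℝ, (AddCircle.toCircle (x : AddCircle (2 * Real.pi)) : ℂ) =
      Complex.exp (x * Complex.I) := by
    intro x
    rw [AddCircle.toCircle_apply_mk, Circle.coe_exp, div_self Real.two_pi_pos.ne', one_mul]
  have hcoeff : ∀ n : ℕ, ‖fourierCoeff F n‖ ≤ M / ρ ^ n := by
    intro n
    refine (le_of_eq (congrArg norm ?_)).trans (norm_joukowski_circleIntegral_le hρ hu hM n)
    have hint : ∀ x : ℝ, deriv (circleMap 0 1) x • ((circleMap 0 1 x ^ (n + 1))⁻¹ *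
        u ((circleMap 0 1 x + (circleMap 0 1 x)⁻¹) / 2)) =
        Complex.I * (fourier (-(n : ℤ)) (x : AddCircle (2 * Real.pi)) • F x) := by
      intro x
      have hc : circleMap 0 1 x = Complex.exp (x * Complex.I) := by simp [circleMap]
      have hf : fourier (-(n : ℤ)) (x : AddCircle (2 * Real.pi)) =
          (Complex.exp (x * Complex.I) ^ n)⁻¹ := by
        rw [fourier_coe_apply, ← Complex.exp_nat_mul, ← Complex.exp_neg]
        have : (Real.pi : ℂ) ≠ 0 := Complex.ofReal_ne_zero.mpr Real.pi_ne_zero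
        congr 1
        push_cast
        field_simp
      rw [deriv_circleMap, hc, hf, hFapp, hcirc, smul_eq_mul, smul_eq_mul, pow_succ]
      have := Complex.exp_ne_zero (x * Complex.I)
      field_simp
    simp only [circleIntegral, hint]
    rw [fourierCoeff_eq_intervalIntegral _ _ 0, zero_add, intervalIntegral.integral_const_mul,
      Complex.real_smul, smul_eq_mul]
    have : (Real.pi : ℂ) ≠ 0 := Complex.ofReal_ne_zero.mpr Real.pi_ne_zero
    push_cast
    field_simp
  have hneg : ∀ n : ℤ, fourierCoeff F (-n) = fourierCoeff F n := fourierCoeff_neg_of_even hFeven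
  have hgeo : Summable fun n : ℕ => M / ρ ^ n := by
    simpa [div_eq_mul_inv, ← inv_pow] using
      (summable_geometric_of_lt_one (by positivity) (inv_lt_one_of_one_lt₀ hρ)).mul_left M
  have hsum : Summable (fourierCoeff F) := by
    have h1 : Summable fun n : ℕ => fourierCoeff F n := hgeo.of_norm_bounded hcoeff
    exact Summable.of_nat_of_neg h1 (by simpa only [hneg] using h1)
  have hM0 : 0 ≤ M := (norm_nonneg _).trans (by simpa using hcoeff 0)
  -- Evenness of `F` folds the indices `k` and `-k` together; the index `0` is its own partner,
  -- hence has no factor `2`.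
  refine ⟨fun k => if k = 0 then fourierCoeff F 0 else 2 * fourierCoeff F k, ?_, fun k => ?_, ?_⟩
  · simpa using hcoeff 0
  · have := hcoeff k
    dsimp only
    split_ifs with h
    · subst h
      simp only [CharP.cast_eq_zero] at this
      linarith [norm_nonneg (fourierCoeff F 0)]
    · simpa using this
  · intro x hx
    have hcos : Real.cos (Real.arccos x) = x := Real.cos_arccos hx.1 hx.2
    set θ := Real.arccos x
    have h1 := (has_pointwise_sum_fourier_series_of_summable hsum (θ : AddCircle _)).nat_add_neg
    -- Pairing `k` with `-k` counts the index `0` twice; one copy is removed.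
    have h2 := h1.sub (hasSum_ite_eq 0 (fourierCoeff F 0))
    have hFθ : F θ = u x := by
      rw [hFapp, hcirc, ← Complex.exp_neg, ← neg_mul]
      congr 1
      rw [← hcos, Complex.ofReal_cos, Complex.cos]
    rw [fourier_zero, smul_eq_mul, mul_one, add_sub_cancel_right, hFθ] at h2
    refine h2.congr_fun fun k => ?_
    have hT : (((Chebyshev.T ℝ k).eval x : ℝ) : ℂ) * 2 =
        fourier (k : ℤ) (θ : AddCircle (2 * Real.pi)) + fourier (-(k : ℤ)) (θ : AddCircle (2 * Real.pi)) := by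
      have hπ : (Real.pi : ℂ) ≠ 0 := Complex.ofReal_ne_zero.mpr Real.pi_ne_zero
      rw [← hcos, Chebyshev.complex_ofReal_eval_T, Complex.ofReal_cos, Chebyshev.T_complex_cos,
        Complex.cos, fourier_coe_apply, fourier_coe_apply, div_mul_cancel₀ _ two_ne_zero]
      congr 2 <;> (push_cast; field_simp)
    rw [hneg, ← smul_add, ← hT]
    dsimp only
    split_ifs with h
    · subst h
      simp
      ring
    · rw [smul_eq_mul]
      ring

/-! ### Termwise integration and the final estimates -/

/-- Dominated convergence: since `|T_k| ≤ 1`, the terms are bounded by `r k * |J_n ω|`. -/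
theorem hasSum_jacobiCoeff {u : ℂ → ℂ} {c : ℕ → ℂ} {r : ℕ → ℝ} (hr : Summable r)
    (hc : ∀ k, ‖c k‖ ≤ r k)
    (hu : ∀ x ∈ Icc (-1 : ℝ) 1, HasSum (fun k => c k * ((Chebyshev.T ℝ k).eval x : ℝ)) (u x))
    (n : ℕ) {a b : ℝ} (ha : -1 < a) (hb : -1 < b) :
    HasSum (fun k => c k * (chebyshevJacobi n k a b : ℂ)) (jacobiCoeff u n a b) := by
  have hJ : IntervalIntegrable (fun x => ‖(jacobi n a b).eval x * jacobiWeight a b x‖)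
      volume (-1) 1 := (intervalIntegrable_mul_jacobiWeight ha hb (jacobi n a b).continuous).norm
  have hI : uIoc (-1 : ℝ) 1 ⊆ Icc (-1) 1 := by
    rw [uIoc_of_le (by norm_num)]
    exact Ioc_subset_Icc_self
  have key := intervalIntegral.hasSum_integral_of_dominated_convergence (μ := volume)
    (a := -1) (b := 1)
    (F := fun k x => c k *
      (((Chebyshev.T ℝ k * jacobi n a b).eval x * jacobiWeight a b x : ℝ) : ℂ))
    (f := fun x : ℝ => u x * (((jacobi n a b).eval x * jacobiWeight a b x : ℝ) : ℂ))
    (fun k x => r k * ‖(jacobi n a b).eval x * jacobiWeight a b x‖) ?_ ?_ ?_ ?_ ?_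
  · convert! key.mul_left (1 / (jacobiGamma n a b : ℂ)) using 2 with k
    rw [intervalIntegral.integral_const_mul, intervalIntegral.integral_ofReal, chebyshevJacobi,
      jacobiIntegral]
    push_cast
    ring
  · intro k
    have h := intervalIntegrable_mul_jacobiWeight ha hb (Chebyshev.T ℝ k * jacobi n a b).continuous
    exact (Complex.continuous_ofReal.comp_aestronglyMeasurable
      h.def'.aestronglyMeasurable).const_mul (c k)
  · refine fun k => Filter.Eventually.of_forall fun x hx => ?_
    have hT := Chebyshev.abs_eval_T_real_le_one k (abs_le.mpr (hI hx))
    rw [norm_mul, Complex.norm_real, eval_mul, mul_assoc, norm_mul ((Chebyshev.T ℝ k).eval x)]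
    exact mul_le_mul (hc k) (mul_le_of_le_one_left (norm_nonneg _) hT) (by positivity)
      ((norm_nonneg _).trans (hc k))
  · exact Filter.Eventually.of_forall fun x _ => hr.mul_right _
  · simp only [tsum_mul_right]
    exact hJ.const_mul _
  · refine Filter.Eventually.of_forall fun x hx => ?_
    refine ((hu x (hI hx)).mul_right
      (((jacobi n a b).eval x * jacobiWeight a b x : ℝ) : ℂ)).congr_fun fun k => ?_
    rw [eval_mul]
    push_cast
    ring

/-- The Jacobi coefficient of a function analytic on the closed region bounded by the Bernstein
ellipse is the sum of a series whose terms are controlled by `σ_{n,0}`, `σ_{n,1}` and the norms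
of the Jacobi polynomials. -/
theorem exists_hasSum_jacobiCoeff {ρ : ℝ} (hρ : 1 < ρ) {u : ℂ → ℂ}
    (hu : AnalyticOnNhd ℂ u (bernsteinRegion ρ)) {M : ℝ}
    (hM : ∀ z ∈ bernsteinEllipse ρ, ‖u z‖ ≤ M) (n : ℕ) {a b : ℝ} (ha : -1 < a) (hb : -1 < b) :
    ∃ d : ℕ → ℂ, HasSum d (jacobiCoeff u n a b) ∧ ‖d 0‖ ≤ M / ρ ^ n * |sigma n 0 a b| ∧
      ‖d 1‖ ≤ M / ρ ^ n * (|sigma n 1 a b| / ρ) ∧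
      (∀ j, ‖d j‖ ≤ M / ρ ^ n * (2 * √(jacobiGamma 0 a b / jacobiGamma n a b) * ρ⁻¹ ^ j)) ∧
      (a = b → ∀ j, Odd j → d j = 0) := by
  have hρ0 : 0 < ρ := by linarith
  obtain ⟨c, hc0, hc, hsum⟩ := exists_chebyshev_expansion hρ hu hM
  have hgeo : Summable fun n : ℕ => 2 * (M / ρ ^ n) := by
    simpa [div_eq_mul_inv, ← inv_pow] using
      ((summable_geometric_of_lt_one (by positivity) (inv_lt_one_of_one_lt₀ hρ)).mul_left
        M).mul_left 2
  have h := hasSum_jacobiCoeff hgeo hc hsum n ha hb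
  have hM0 : 0 ≤ M := (norm_nonneg _).trans hc0
  have hshift : HasSum (fun j => c (n + j) * (chebyshevJacobi n (n + j) a b : ℂ))
      (jacobiCoeff u n a b) := by
    have h2 := (hasSum_nat_add_iff' n).mpr h
    rw [Finset.sum_eq_zero fun k hk => by
      rw [chebyshevJacobi_of_lt (Finset.mem_range.mp hk) ha hb, Complex.ofReal_zero, mul_zero],
      sub_zero] at h2
    simpa only [add_comm n] using h2
  have hbound : ∀ j < 2, n + j ≠ 0 → ‖c (n + j) * (chebyshevJacobi n (n + j) a b : ℂ)‖ ≤
      M / ρ ^ (n + j) * |sigma n j a b| := by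
    intro j hj hnj
    rw [← two_mul_chebyshevJacobi_add hj hnj ha hb, norm_mul, Complex.norm_real, abs_mul, abs_two,
      Real.norm_eq_abs]
    calc _ ≤ 2 * (M / ρ ^ (n + j)) * |chebyshevJacobi n (n + j) a b| := by gcongr; exact hc _
      _ = _ := by ring
  refine ⟨_, hshift, ?_, ?_, fun j => ?_, ?_⟩
  -- For `n = 0` the coefficient of `T_0 = U_0` lacks the factor `1/2`; the sharper bound `‖c 0‖ ≤
  -- M` makes up for it.
  · rcases n with - | n
    · rw [norm_mul, Complex.norm_real, Real.norm_eq_abs, zero_add, chebyshevJacobi_zero_zero]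
      simpa using mul_le_mul_of_nonneg_right hc0 (abs_nonneg _)
    · simpa using hbound 0 two_pos (by omega)
  · refine (hbound 1 one_lt_two (by omega)).trans_eq ?_
    rw [pow_succ]
    field_simp
  · rw [norm_mul, Complex.norm_real, Real.norm_eq_abs]
    calc _ ≤ 2 * (M / ρ ^ (n + j)) * √(jacobiGamma 0 a b / jacobiGamma n a b) := by
          gcongr
          · exact hc _
          · exact abs_chebyshevJacobi_le n _ ha hb
      _ = _ := by rw [pow_add, inv_pow]; field_simp
  · rintro rfl j hj
    rw [chebyshevJacobi_of_odd n j hj, Complex.ofReal_zero, mul_zero]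

theorem norm_jacobiCoeff_le {ρ : ℝ} (hρ : 1 < ρ) {u : ℂ → ℂ}
    (hu : AnalyticOnNhd ℂ u (bernsteinRegion ρ)) {M : ℝ}
    (hM : ∀ z ∈ bernsteinEllipse ρ, ‖u z‖ ≤ M) (n : ℕ) {a b : ℝ} (ha : -1 < a) (hb : -1 < b) :
    ‖jacobiCoeff u n a b‖ ≤ M / ρ ^ n * (|sigma n 0 a b| + |sigma n 1 a b| / ρ +
      2 / (ρ * (ρ - 1)) * √(jacobiGamma 0 a b / jacobiGamma n a b)) := by
  obtain ⟨d, hd, h0, h1, h2, -⟩ := exists_hasSum_jacobiCoeff hρ hu hM n ha hb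
  have hρ0 : 0 < ρ := by linarith
  have hρ1 : ρ - 1 ≠ 0 := by linarith
  set S := √(jacobiGamma 0 a b / jacobiGamma n a b)
  -- The tail starts at `j = 2`, the terms `d 0` and `d 1` being bounded by `σ_{n,0}` and `σ_{n,1}`.
  have hg : HasSum (fun j => M / ρ ^ n * (2 * S * ρ⁻¹ ^ (j + 2)))
      (M / ρ ^ n * (2 / (ρ * (ρ - 1)) * S)) := by
    convert! (hasSum_geometric_of_lt_one (by positivity) (inv_lt_one_of_one_lt₀ hρ)).mul_left
      (M / ρ ^ n * (2 * S * ρ⁻¹ ^ 2)) using 1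
    · ext j; ring
    · have : 1 - ρ⁻¹ ≠ 0 := by
        have := inv_lt_one_of_one_lt₀ hρ
        linarith
      field_simp
  have htail := ((hasSum_nat_add_iff' 2).mpr hd).norm_le_of_bounded hg fun j => h2 (j + 2)
  rw [Finset.sum_range_succ, Finset.sum_range_one] at htail
  calc ‖jacobiCoeff u n a b‖ = ‖(jacobiCoeff u n a b - (d 0 + d 1)) + d 0 + d 1‖ := by ring_nf
    _ ≤ ‖jacobiCoeff u n a b - (d 0 + d 1)‖ + ‖d 0‖ + ‖d 1‖ := norm_add₃_le
    _ ≤ _ := by linarith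

theorem norm_jacobiCoeff_self_le {ρ : ℝ} (hρ : 1 < ρ) {u : ℂ → ℂ}
    (hu : AnalyticOnNhd ℂ u (bernsteinRegion ρ)) {M : ℝ}
    (hM : ∀ z ∈ bernsteinEllipse ρ, ‖u z‖ ≤ M) (n : ℕ) {a : ℝ} (ha : -1 < a) :
    ‖jacobiCoeff u n a a‖ ≤ M / ρ ^ n * (|sigma n 0 a a| +
      2 / (ρ ^ 2 - 1) * √(jacobiGamma 0 a a / jacobiGamma n a a)) := by
  obtain ⟨d, hd, h0, -, h2, hodd⟩ := exists_hasSum_jacobiCoeff hρ hu hM n ha ha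
  have hρ0 : 0 < ρ := by linarith
  have hinv : (ρ⁻¹ ^ 2) < 1 := pow_lt_one₀ (by positivity) (inv_lt_one_of_one_lt₀ hρ) two_ne_zero
  have hρ1 : ρ ^ 2 - 1 ≠ 0 := by nlinarith
  set S := √(jacobiGamma 0 a a / jacobiGamma n a a)
  -- Only even offsets survive, so the geometric ratio improves from `ρ⁻¹` to `ρ⁻²`.
  have heven : HasSum (fun j => d (2 * j)) (jacobiCoeff u n a a) := by
    refine (Function.Injective.hasSum_iff (mul_right_injective₀ two_ne_zero) fun j hj => ?_).mpr hd
    refine hodd rfl j (Nat.not_even_iff_odd.mp fun he => hj ?_)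
    obtain ⟨m, rfl⟩ := he
    exact ⟨m, by ring⟩
  have hg : HasSum (fun j => M / ρ ^ n * (2 * S * ρ⁻¹ ^ (2 * (j + 1))))
      (M / ρ ^ n * (2 / (ρ ^ 2 - 1) * S)) := by
    convert! (hasSum_geometric_of_lt_one (by positivity) hinv).mul_left
      (M / ρ ^ n * (2 * S * ρ⁻¹ ^ 2)) using 1
    · ext j
      rw [pow_mul, pow_succ]
      ring
    · have : 1 - ρ⁻¹ ^ 2 ≠ 0 := by linarith
      rw [inv_pow] at this ⊢
      field_simp
  have htail := ((hasSum_nat_add_iff' 1).mpr heven).norm_le_of_bounded hg fun j => h2 (2 * (j + 1))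
  rw [Finset.sum_range_one, mul_zero] at htail
  calc ‖jacobiCoeff u n a a‖ = ‖(jacobiCoeff u n a a - d 0) + d 0‖ := by ring_nf
    _ ≤ ‖jacobiCoeff u n a a - d 0‖ + ‖d 0‖ := norm_add_le _ _
    _ ≤ _ := by linarith

end JacobiExpansion

end

theorem mainTheorem1 (ρ : ℝ) (hρ : 1 < ρ) (u : ℂ → ℂ)
    (hu : AnalyticOnNhd ℂ u (JacobiExpansion.bernsteinRegion ρ))
    (M : ℝ) (hM : IsGreatest ((fun z => ‖u z‖) '' JacobiExpansion.bernsteinEllipse ρ) M)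
    (α β : ℝ) (hα : -1 < α) (hβ : -1 < β) (n : ℕ) :
    ‖JacobiExpansion.jacobiCoeff u n α β‖ ≤
        M / ρ ^ n * (|JacobiExpansion.sigma n 0 α β| + |JacobiExpansion.sigma n 1 α β| / ρ +
          2 / (ρ * (ρ - 1)) *
            √(JacobiExpansion.jacobiGamma 0 α β / JacobiExpansion.jacobiGamma n α β)) ∧
    (n ≠ 0 ∨ α + β + 1 ≠ 0 →
      JacobiExpansion.sigma n 0 α β =
        √Real.pi / 2 * ((2 * n + 1)! * Real.Gamma (n + α + β + 1) /
          (Real.Gamma (n + 3 / 2) * Real.Gamma (2 * n + α + β + 1)))) ∧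
    (n = 0 ∧ α + β + 1 = 0 → JacobiExpansion.sigma n 0 α β = 1) ∧
    JacobiExpansion.sigma n 1 α β =
      (β - α) * (2 * n + 2) / (2 * n + α + β + 2) * JacobiExpansion.sigma n 0 α β ∧
    (α = β →
      ‖JacobiExpansion.jacobiCoeff u n α α‖ ≤
        M / ρ ^ n * (|JacobiExpansion.sigma n 0 α α| +
          2 / (ρ ^ 2 - 1) *
            √(JacobiExpansion.jacobiGamma 0 α α / JacobiExpansion.jacobiGamma n α α))) := by
  have hM' : ∀ z ∈ JacobiExpansion.bernsteinEllipse ρ, ‖u z‖ ≤ M :=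
    fun z hz => hM.2 (Set.mem_image_of_mem _ hz)
  refine ⟨JacobiExpansion.norm_jacobiCoeff_le hρ hu hM' n hα hβ,
    JacobiExpansion.sigma_zero_eq_Gamma hα hβ, ?_, JacobiExpansion.sigma_one_eq n hα hβ,
    fun _ => JacobiExpansion.norm_jacobiCoeff_self_le hρ hu hM' n hα⟩
  rintro ⟨rfl, -⟩
  simp [JacobiExpansion.sigma_zero_eq 0 hα hβ]
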